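/- Consider the Delayed Feedback Vertex Set problem with reservations, for a constant reservation cost $\alpha\in\mathbb{R}_{\ge 0}$. An instance is a finite simple graph $G$ whose vertices $v_1,\dots,v_n$ are presented one after the other, each together with its edges to the previous vertices. After $v_i$ has been presented, a (deterministic) online algorithm must fix, depending only on the graph $G[\{v_1,\dots,v_i\}]$ revealed so far (with its order of presentation), sets $S_i,R_i\subseteq\{v_1,\dots,v_i\}$ of selected and of reserved vertices such that $S_1\subseteq\dots\subseteq S_n$, $R_1\subseteq\dots\subseteq R_n$, and $G[\{v_1,\dots,v_i\}\setminus(S_i\cup R_i)]$ is cycle-free for every $i$. Its cost on $G$ is $|S_n|+|T|+\alpha|R_n|$, where $T\subseteq V(G)$ is a set of minimum size such that $G-(S_n\cup T)$ is cycle-free. The algorithm is (strictly) $c$-competitive if on every instance $G$ its cost is at most $c\cdot\mathrm{OPT}(G)$, where $\mathrm{OPT}(G)$ is the minimum size of a feedback vertex set of $G$, i.e. of a set of vertices whose deletion leaves a cycle-free graph. Then for every $\alpha\ge 0$ there is a $\min\{5,\,1+5\alpha\}$-competitive algorithm for the Delayed Feedback Vertex Set problem with reservations. -/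

import Mathlib

/-! Feedback vertex set, online, with delayed decisions and reservations.

An online instance with `n` vertices is a finite simple graph `G` on `Fin n`; the vertices are
presented in their natural order, each together with its edges to the vertices before it. -/

namespace DelayedFVS

/-- `S` is a feedback vertex set of `G`: deleting `S` leaves a cycle-free graph. -/
def IsFVS {V : Type*} (G : SimpleGraph V) (S : Set V) : Prop :=
  (G.induce Sᶜ).IsAcyclic

/-- The graph that has been revealed once the first `i` vertices of `G` have been presented,
that is, the subgraph of `G` induced by these vertices. -/
def revealed {n : ℕ} (G : SimpleGraph (Fin n)) (i : ℕ) (hi : i ≤ n) : SimpleGraph (Fin i) :=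
  G.comap (Fin.castLE hi)

/-- The least number of vertices which, together with `S`, form a feedback vertex set of `G`. -/
noncomputable def completionSize {n : ℕ} (G : SimpleGraph (Fin n)) (S : Finset (Fin n)) : ℕ :=
  sInf {k : ℕ | ∃ T : Finset (Fin n), IsFVS G ((S : Set (Fin n)) ∪ (T : Set (Fin n))) ∧ T.card = k}

/-- The optimal offline cost: the least size of a feedback vertex set of `G`. -/
noncomputable def opt {n : ℕ} (G : SimpleGraph (Fin n)) : ℕ :=
  sInf {k : ℕ | ∃ S : Finset (Fin n), IsFVS G (S : Set (Fin n)) ∧ S.card = k}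

theorem isFVS_univ {V : Type*} (G : SimpleGraph V) : IsFVS G Set.univ := by
  intro v
  exact absurd (Set.mem_univ v.1) v.2

/-- The set of candidates in `completionSize` is not empty, so its infimum is a minimum. -/
theorem completionSize_spec {n : ℕ} (G : SimpleGraph (Fin n)) (S : Finset (Fin n)) :
    ∃ T : Finset (Fin n), IsFVS G ((S : Set (Fin n)) ∪ (T : Set (Fin n))) ∧
      T.card = completionSize G S := by
  refine Nat.sInf_mem (s := {k : ℕ | ∃ T : Finset (Fin n),
    IsFVS G ((S : Set (Fin n)) ∪ (T : Set (Fin n))) ∧ T.card = k}) ⟨_, Finset.univ, ?_, rfl⟩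
  simpa using isFVS_univ G

/-- The set of candidates in `opt` is not empty, so its infimum is a minimum. -/
theorem opt_spec {n : ℕ} (G : SimpleGraph (Fin n)) :
    ∃ S : Finset (Fin n), IsFVS G (S : Set (Fin n)) ∧ S.card = opt G := by
  refine Nat.sInf_mem (s := {k : ℕ | ∃ S : Finset (Fin n),
    IsFVS G (S : Set (Fin n)) ∧ S.card = k}) ⟨_, Finset.univ, ?_, rfl⟩
  simpa using isFVS_univ G

/-- A deterministic online strategy: a rule that gives, from the graph revealed so far (and
nothing else, in particular not the length of the instance), the set of all vertices selected
so far and the set of all vertices reserved so far. -/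
structure OnlineStrategy where
  select : (i : ℕ) → SimpleGraph (Fin i) → Finset (Fin i)
  reserve : (i : ℕ) → SimpleGraph (Fin i) → Finset (Fin i)

namespace OnlineStrategy

/-- `S_i`: the vertices selected after the first `i` vertices of `G` have been presented. -/
def selected (A : OnlineStrategy) {n : ℕ} (G : SimpleGraph (Fin n)) (i : ℕ) (hi : i ≤ n) :
    Finset (Fin n) :=
  (A.select i (revealed G i hi)).map (Fin.castLEEmb hi)

/-- `R_i`: the vertices reserved after the first `i` vertices of `G` have been presented. -/
def reserved (A : OnlineStrategy) {n : ℕ} (G : SimpleGraph (Fin n)) (i : ℕ) (hi : i ≤ n) :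
    Finset (Fin n) :=
  (A.reserve i (revealed G i hi)).map (Fin.castLEEmb hi)

/-- `A` is an algorithm for the delayed feedback vertex set problem with reservations: on every
instance selections and reservations are never revoked, and after every step the revealed graph
without the selected and the reserved vertices is cycle-free. -/
structure IsAlgorithm (A : OnlineStrategy) : Prop where
  selected_mono : ∀ (n : ℕ) (G : SimpleGraph (Fin n)) (i j : ℕ) (hij : i ≤ j) (hj : j ≤ n),
    A.selected G i (hij.trans hj) ⊆ A.selected G j hj
  reserved_mono : ∀ (n : ℕ) (G : SimpleGraph (Fin n)) (i j : ℕ) (hij : i ≤ j) (hj : j ≤ n),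
    A.reserved G i (hij.trans hj) ⊆ A.reserved G j hj
  valid : ∀ (n : ℕ) (G : SimpleGraph (Fin n)) (i : ℕ) (hi : i ≤ n),
    (G.induce {v : Fin n | v.val < i ∧ v ∉ A.selected G i hi ∧ v ∉ A.reserved G i hi}).IsAcyclic

/-- The cost `|S_n| + |T| + α |R_n|` of `A` on `G`, where `T` is a smallest set of vertices that
completes `S_n` to a feedback vertex set of `G` when the instance has ended. -/
noncomputable def cost (A : OnlineStrategy) (α : ℝ) {n : ℕ} (G : SimpleGraph (Fin n)) : ℝ :=
  ((A.selected G n le_rfl).card : ℝ) + (completionSize G (A.selected G n le_rfl) : ℝ)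
    + α * ((A.reserved G n le_rfl).card : ℝ)

/-- `A` is (strictly) `c`-competitive for the reservation cost `α`. -/
def IsCompetitive (A : OnlineStrategy) (α c : ℝ) : Prop :=
  ∀ (n : ℕ) (G : SimpleGraph (Fin n)), A.cost α G ≤ c * (opt G : ℝ)

end OnlineStrategy

end DelayedFVS

/-!
The algorithm maintains a subgraph `H` of maximum degree three and a set `S` of selected vertices
meeting all cycles of `H`. While a cycle of the revealed graph avoids `S`, it extends `H` by an ear
between two vertices of degree at most two, whose ends join `S`, or by a disjoint cycle, one vertex
of which joins `S`, or it lets a vertex of `H` of degree at most two join `S` because a cycle is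
attached there that meets neither the rest of `H` nor the other attached cycles. If no ear exists,
then a cycle that avoids `S` and allows neither of the last two steps meets one attached cycle, off
`H`; the latter is exchanged for the new cycle, added to `H` together with a connecting ear.

The excess of the number of edges over the number of vertices of `H` grows by one with each ear, so
`|S|` is at most twice this excess plus the number of disjoint cycles and of attached cycles. Let
`F` be a feedback vertex set. Since `H - F` is a forest, a vertex of degree `d` in `F` accounts for
`d - 1` of the excess; besides, it may account for one disjoint cycle and, if `d ≤ 2`, for one
attached cycle. So it pays for at most `2 * 2 + 1` or `2 * 1 + 1 + 1` selected vertices, whence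
`|S| ≤ 5 |F|`. Selecting `S` costs at most `5 OPT`, and reserving `S` at most `(1 + 5 α) OPT`.
-/

namespace DelayedFVS

open SimpleGraph Finset

section EdgeSets

variable {V : Type*} [DecidableEq V] {E E' : Finset (Sym2 V)} {x : V}

/-- The vertices of the graph with edge set `E`. Subgraphs are encoded by their edge sets, since no
subgraph considered below has isolated vertices. -/
def edgeVerts (E : Finset (Sym2 V)) : Finset V := E.biUnion Sym2.toFinset

/-- The degree of `x` in the graph with edge set `E`. -/
def edgeDeg (E : Finset (Sym2 V)) (x : V) : ℕ := #{e ∈ E | x ∈ e}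

theorem mem_edgeVerts : x ∈ edgeVerts E ↔ ∃ e ∈ E, x ∈ e := by
  simp [edgeVerts]

theorem edgeVerts_union : edgeVerts (E ∪ E') = edgeVerts E ∪ edgeVerts E' :=
  union_biUnion

theorem edgeDeg_eq_zero_iff : edgeDeg E x = 0 ↔ x ∉ edgeVerts E := by
  simp [edgeDeg, mem_edgeVerts, filter_eq_empty_iff]

theorem edgeDeg_union_le : edgeDeg (E ∪ E') x ≤ edgeDeg E x + edgeDeg E' x := by
  rw [edgeDeg, filter_union]
  exact card_union_le _ _

theorem edgeDeg_union_le_max (hx : x ∈ edgeVerts E → x ∉ edgeVerts E') :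
    edgeDeg (E ∪ E') x ≤ max (edgeDeg E x) (edgeDeg E' x) := by
  have hle := edgeDeg_union_le (E := E) (E' := E') (x := x)
  by_cases hxE : x ∈ edgeVerts E
  · have := edgeDeg_eq_zero_iff.2 (hx hxE)
    omega
  · have := edgeDeg_eq_zero_iff.2 hxE
    omega

end EdgeSets

section Walks

theorem exists_ne_mem_edges_of_isCycle {V : Type*} {G : SimpleGraph V} {v x : V}
    {c : G.Walk v v} (hc : c.IsCycle) (hx : x ∈ c.support) :
    ∃ y z, y ≠ z ∧ s(x, y) ∈ c.edges ∧ s(x, z) ∈ c.edges := by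
  classical
  have hrot := hc.rotate hx
  refine ⟨_, _, hrot.snd_ne_penultimate, ?_, ?_⟩
  · exact (c.rotate_edges x hx).mem_iff.1 (Walk.mk_start_snd_mem_edges hrot.not_nil)
  · rw [Sym2.eq_swap]
    exact (c.rotate_edges x hx).mem_iff.1 (Walk.mk_penultimate_end_mem_edges hrot.not_nil)

variable {V : Type*} [DecidableEq V] {G : SimpleGraph V} {a b v x : V}

theorem edgeVerts_edges {p : G.Walk a b} (hp : ¬ p.Nil) :
    edgeVerts p.edges.toFinset = p.support.toFinset := by
  ext x
  simp [mem_edgeVerts, Walk.mem_support_iff_exists_mem_edges_of_not_nil hp]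

theorem countP_mem_edges_add_ite (p : G.Walk a b) (x : V) :
    p.edges.countP (x ∈ ·) + (if x = a then 1 else 0) + (if x = b then 1 else 0) =
      2 * p.support.count x := by
  induction p with
  | @nil u => by_cases h : u = x <;> simp [h, eq_comm (a := x)]
  | @cons a c b h p ih =>
    have hac : ¬ (x = a ∧ x = c) := fun hx => h.ne (hx.1.symm.trans hx.2)
    rw [Walk.edges_cons, Walk.support_cons, List.countP_cons, List.count_cons]
    simp only [Sym2.mem_iff, decide_eq_true_eq, beq_iff_eq, eq_comm (a := a)]
    split_ifs at ih ⊢ <;> first | omega | tauto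

theorem edgeDeg_edges_add_ite_le (p : G.Walk a b) (x : V) :
    edgeDeg p.edges.toFinset x + (if x = a then 1 else 0) + (if x = b then 1 else 0) ≤
      2 * p.support.count x := by
  rw [← countP_mem_edges_add_ite, edgeDeg, List.countP_eq_length_filter]
  gcongr
  refine (card_le_card fun e he => ?_).trans (List.toFinset_card_le _)
  simpa using he

theorem edgeDeg_path_le_two {p : G.Walk a b} (hp : p.IsPath) (x : V) :
    edgeDeg p.edges.toFinset x ≤ 2 := by
  have := edgeDeg_edges_add_ite_le p x
  have := List.nodup_iff_count_le_one.1 hp.support_nodup x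
  omega

theorem edgeDeg_path_endpoint_le_one {p : G.Walk a b} (hp : p.IsPath) (hx : x = a ∨ x = b) :
    edgeDeg p.edges.toFinset x ≤ 1 := by
  have := edgeDeg_edges_add_ite_le p x
  have := List.nodup_iff_count_le_one.1 hp.support_nodup x
  rcases hx with rfl | rfl <;> simp only [if_true] at * <;> omega

theorem edgeDeg_cycle_le_two {c : G.Walk v v} (hc : c.IsCycle) (x : V) :
    edgeDeg c.edges.toFinset x ≤ 2 := by
  have hdeg := edgeDeg_edges_add_ite_le c x
  have hcount := List.nodup_iff_count_le_one.1 hc.support_nodup x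
  rw [← c.cons_tail_support, List.count_cons] at hdeg
  simp only [beq_iff_eq, eq_comm (a := v)] at hdeg
  split_ifs at hdeg <;> omega

theorem card_edges_of_isTrail {p : G.Walk a b} (hp : p.IsTrail) :
    #p.edges.toFinset = p.length := by
  rw [List.toFinset_card_of_nodup hp.edges_nodup, Walk.length_edges]

theorem card_support_of_isPath {p : G.Walk a b} (hp : p.IsPath) :
    #p.support.toFinset = p.length + 1 := by
  rw [List.toFinset_card_of_nodup hp.support_nodup, Walk.length_support]

theorem card_support_of_isCycle {c : G.Walk v v} (hc : c.IsCycle) :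
    #c.support.toFinset = c.length := by
  rw [← c.cons_tail_support, List.toFinset_cons,
    insert_eq_of_mem (List.mem_toFinset.2 (c.end_mem_tail_support hc.not_nil)),
    List.toFinset_card_of_nodup hc.support_nodup, List.length_tail, Walk.length_support,
    Nat.add_sub_cancel]

/- The cycle has two edges at each of its vertices, but an inner vertex of `p` is incident only to
its two neighbours on `p`. So if the cycle misses a vertex of `p`, it misses the next one. -/
theorem edges_subset_of_isCycle_of_start_notMem {H : SimpleGraph V} {E : Finset (Sym2 V)}
    {p : G.Walk a b} (hp : p.IsPath)
    (hE : ∀ x ∈ p.support, x ∈ edgeVerts E → x = a ∨ x = b)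
    {c : H.Walk v v} (hc : c.IsCycle) (hcE : ∀ e ∈ c.edges, e ∈ E ∨ e ∈ p.edges)
    (ha : a ∉ c.support) : ∀ e ∈ c.edges, e ∈ E := by
  induction p with
  | nil => simpa using hcE
  | @cons a a' b h p ih =>
    obtain ⟨hp, hap⟩ := (Walk.cons_isPath_iff _ _).1 hp
    have hcE' : ∀ e ∈ c.edges, e ∈ E ∨ e ∈ p.edges := by
      intro e he
      refine (hcE e he).imp_right fun hep => ?_
      rcases List.mem_cons.1 (Walk.edges_cons h p ▸ hep) with rfl | hep
      · exact absurd (c.fst_mem_support_of_mem_edges he) ha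
      · exact hep
    have hinner : ∀ x ∈ p.support, x ∈ edgeVerts E → x = b := fun x hx hxE =>
      (hE x (by simp [hx]) hxE).resolve_left fun hxa => hap (hxa ▸ hx)
    by_cases ha'E : a' ∈ edgeVerts E
    · obtain rfl := hinner a' p.start_mem_support ha'E
      obtain rfl := (Walk.isPath_iff_nil.1 hp).eq_nil
      simpa using hcE'
    · refine ih hp (fun x hx hxE => Or.inr (hinner x hx hxE)) hcE' fun ha' => ?_
      obtain ⟨y, z, hyz, hy, hz⟩ := exists_ne_mem_edges_of_isCycle hc ha'
      have eq_snd : ∀ w, s(a', w) ∈ c.edges → w = p.snd := fun w hw =>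
        hp.eq_snd_of_mem_edges <| (hcE' _ hw).resolve_left fun hwE =>
          ha'E (mem_edgeVerts.2 ⟨_, hwE, by simp⟩)
      exact hyz ((eq_snd y hy).trans (eq_snd z hz).symm)

end Walks

section FeedbackVertexSets

variable {V W : Type*} {G G' : SimpleGraph V} {H : SimpleGraph W} {S S' : Set V}

theorem isFVS_iff :
    IsFVS G S ↔ ∀ (v : V) (c : G.Walk v v), c.IsCycle → ∃ y ∈ c.support, y ∈ S := by
  refine ⟨fun hS v c hc => ?_, fun hS v c hc => ?_⟩
  · by_contra! hmiss
    refine hS _ (Walk.IsCycle.of_map (f := (Embedding.induce Sᶜ).toHom) (p := c.induce Sᶜ hmiss) ?_)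
    rwa [Walk.map_induce]
  · obtain ⟨y, hy, hyS⟩ := hS _ _ (hc.map (f := (Embedding.induce Sᶜ).toHom) Subtype.val_injective)
    rw [Walk.support_map, List.mem_map] at hy
    obtain ⟨⟨z, hz⟩, -, rfl⟩ := hy
    exact hz hyS

theorem IsFVS.mono (hS : IsFVS G S) (hSS' : S ⊆ S') : IsFVS G S' :=
  isFVS_iff.2 fun v c hc => (isFVS_iff.1 hS v c hc).imp fun _ hy => hy.imp_right (hSS' ·)

theorem IsFVS.comap {T : Set W} (hT : IsFVS H T) (f : G →g H) (hf : Function.Injective f) :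
    IsFVS G (f ⁻¹' T) := by
  refine isFVS_iff.2 fun v c hc => ?_
  simpa using isFVS_iff.1 hT _ _ (hc.map hf)

theorem IsFVS.anti (hS : IsFVS G S) (hGG' : G' ≤ G) : IsFVS G' S :=
  hS.comap (Hom.ofLE hGG') Function.injective_id

theorem IsFVS.map (hS : IsFVS G S) (f : V ↪ W) : IsFVS (G.map f) (f '' S) := by
  refine isFVS_iff.2 fun v c hc => ?_
  by_contra! hmiss
  have hsupp : ∀ z ∈ c.support, z ∈ f '' Sᶜ := by
    intro z hz
    obtain ⟨y, -, -, hzy, -⟩ := exists_ne_mem_edges_of_isCycle hc hz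
    obtain ⟨u, -, -, rfl, -⟩ := (map_adj f G z y).1 (c.edges_subset_edgeSet hzy)
    exact ⟨u, fun hu => hmiss _ hz ⟨u, hu, rfl⟩, rfl⟩
  choose r hrS hfr using fun z : f '' Sᶜ => z.2
  let g : (G.map f).induce (f '' Sᶜ) →g G.induce Sᶜ :=
    { toFun := fun z => ⟨r z, hrS z⟩
      map_rel' := fun {y z} hyz => by
        rw [induce_adj, ← hfr y, ← hfr z] at hyz
        exact (map_adj_apply (f := f)).1 hyz }
  have hg : Function.Injective g := fun y z hyz => Subtype.ext <| by
    rw [← hfr y, ← hfr z]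
    exact congrArg (f ∘ Subtype.val) hyz
  refine IsAcyclic.comap g hg hS (c.induce _ hsupp)
    (Walk.IsCycle.of_map (f := (Embedding.induce _).toHom) ?_)
  rwa [Walk.map_induce]

theorem IsFVS.exists_mem_support {E : Set (Sym2 V)} (hS : IsFVS (fromEdgeSet E) S) {v : V}
    {c : G.Walk v v} (hc : c.IsCycle) (hcE : ∀ e ∈ c.edges, e ∈ E) : ∃ y ∈ c.support, y ∈ S := by
  have hcE' : ∀ e ∈ c.edges, e ∈ (fromEdgeSet E).edgeSet := fun e he => by
    rw [edgeSet_fromEdgeSet]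
    exact ⟨hcE e he, G.not_isDiag_of_mem_edgeSet (c.edges_subset_edgeSet he)⟩
  simpa using isFVS_iff.1 hS v _ (hc.transfer hcE')

variable [DecidableEq V] {E : Finset (Sym2 V)} {a b x : V}

theorem isFVS_edgeVerts : IsFVS (fromEdgeSet (E : Set (Sym2 V))) (edgeVerts E) := by
  refine isFVS_iff.2 fun v c hc => ⟨v, c.start_mem_support, ?_⟩
  obtain ⟨y, -, -, hy, -⟩ := exists_ne_mem_edges_of_isCycle hc c.start_mem_support
  have := c.edges_subset_edgeSet hy
  rw [edgeSet_fromEdgeSet] at this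
  exact mem_coe.2 (mem_edgeVerts.2 ⟨_, this.1, by simp⟩)

theorem IsFVS.union_path (hS : IsFVS (fromEdgeSet (E : Set (Sym2 V))) S) {p : G.Walk a b}
    (hp : p.IsPath) (hE : ∀ x ∈ p.support, x ∈ edgeVerts E → x = a ∨ x = b) :
    IsFVS (fromEdgeSet (↑(E ∪ p.edges.toFinset) : Set (Sym2 V))) (insert a S) := by
  refine isFVS_iff.2 fun v c hc => ?_
  by_cases ha : a ∈ c.support
  · exact ⟨a, ha, Set.mem_insert _ _⟩
  have hcE : ∀ e ∈ c.edges, e ∈ E := by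
    refine edges_subset_of_isCycle_of_start_notMem hp hE hc (fun e he => ?_) ha
    have := c.edges_subset_edgeSet he
    rw [edgeSet_fromEdgeSet] at this
    simpa using this.1
  exact (hS.exists_mem_support hc hcE).imp fun y hy => hy.imp_right (Set.mem_insert_of_mem a)

theorem IsFVS.union_cycle (hS : IsFVS (fromEdgeSet (E : Set (Sym2 V))) S) {c : G.Walk x x}
    (hc : c.IsCycle) (hE : ∀ y ∈ c.support, y ∉ edgeVerts E) :
    IsFVS (fromEdgeSet (↑(E ∪ c.edges.toFinset) : Set (Sym2 V))) (insert x S) := by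
  refine isFVS_iff.2 fun v d hd => ?_
  by_cases hx : x ∈ d.support
  · exact ⟨x, hx, Set.mem_insert _ _⟩
  cases c with
  | nil => exact absurd rfl hc.ne_nil
  | @cons _ y h p =>
    have hp := ((Walk.cons_isCycle_iff _ _).1 hc).1
    have hdE : ∀ e ∈ d.edges, e ∈ E := by
      refine edges_subset_of_isCycle_of_start_notMem hp.reverse
        (fun z hz hzE => absurd hzE (hE z ?_)) hd (fun e he => ?_) hx
      · exact List.mem_cons_of_mem _ (by simpa using hz)
      · have := d.edges_subset_edgeSet he
        rw [edgeSet_fromEdgeSet] at this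
        have hne : e ≠ s(x, y) := fun heq =>
          hx (d.fst_mem_support_of_mem_edges (heq ▸ he))
        simpa [hne] using this.1
    exact (hS.exists_mem_support hd hdE).imp fun y hy => hy.imp_right (Set.mem_insert_of_mem x)

theorem card_edgeFinset_le_of_isAcyclic [Fintype W] [Fintype H.edgeSet] (hH : H.IsAcyclic) :
    #H.edgeFinset ≤ Fintype.card W := by
  classical
  cases isEmpty_or_nonempty W
  · simp [Subsingleton.elim H ⊥]
  · obtain ⟨T, hHT, -, hT⟩ :=
      (connected_top (V := W)).exists_isTree_le_of_le_of_isAcyclic (H := H) le_top hH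
    have := card_le_card (edgeFinset_mono hHT)
    have := hT.card_edgeFinset
    omega

theorem card_le_card_edgeVerts_of_isAcyclic (hE : ↑E ⊆ G.edgeSet)
    (hacyc : (fromEdgeSet (E : Set (Sym2 V))).IsAcyclic) : #E ≤ #(edgeVerts E) := by
  classical
  let H := (fromEdgeSet (E : Set (Sym2 V))).induce (edgeVerts E : Set V)
  have hsub : E ⊆ H.edgeFinset.image (Sym2.map Subtype.val) := by
    intro e he
    induction e using Sym2.ind with | _ x y =>
    have hmem : ∀ z ∈ s(x, y), z ∈ edgeVerts E := fun z hz => mem_edgeVerts.2 ⟨_, he, hz⟩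
    refine mem_image.2 ⟨s(⟨x, hmem x (by simp)⟩, ⟨y, hmem y (by simp)⟩), ?_, rfl⟩
    rw [mem_edgeFinset, mem_edgeSet]
    exact (fromEdgeSet_adj _).2 ⟨he, (show G.Adj x y from hE he).ne⟩
  calc #E ≤ #H.edgeFinset := (card_le_card hsub).trans card_image_le
    _ ≤ Fintype.card (edgeVerts E : Set V) := card_edgeFinset_le_of_isAcyclic (hacyc.induce _)
    _ = #(edgeVerts E) := by simp

theorem IsFVS.card_edges_le {F : Finset V} (hF : IsFVS G F) (hE : ↑E ⊆ G.edgeSet) :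
    #E ≤ #(edgeVerts E \ F) + ∑ x ∈ F, edgeDeg E x := by
  have hforest : #{e ∈ E | ∀ x ∈ F, x ∉ e} ≤ #(edgeVerts E \ F) := by
    set E' := {e ∈ E | ∀ x ∈ F, x ∉ e} with hE'
    have hE'G : ↑E' ⊆ G.edgeSet := (coe_subset.2 (filter_subset _ _)).trans hE
    have hacyc : (fromEdgeSet (E' : Set (Sym2 V))).IsAcyclic := by
      intro v c hc
      have hle : fromEdgeSet (E' : Set (Sym2 V)) ≤ G := fun x y hxy =>
        hE'G ((fromEdgeSet_adj _).1 hxy).1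
      obtain ⟨y, hy, hyF⟩ := isFVS_iff.1 (hF.anti hle) v c hc
      obtain ⟨z, -, -, hz, -⟩ := exists_ne_mem_edges_of_isCycle hc hy
      have hzE := ((fromEdgeSet_adj _).1 (c.edges_subset_edgeSet hz)).1
      exact (mem_filter.1 (mem_coe.1 hzE)).2 y hyF (by simp)
    refine (card_le_card_edgeVerts_of_isAcyclic hE'G hacyc).trans (card_le_card fun x hx => ?_)
    obtain ⟨e, he, hxe⟩ := mem_edgeVerts.1 hx
    rw [hE', mem_filter] at he
    exact mem_sdiff.2 ⟨mem_edgeVerts.2 ⟨e, he.1, hxe⟩, fun hxF => he.2 x hxF hxe⟩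
  have hincident : #{e ∈ E | ¬ ∀ x ∈ F, x ∉ e} ≤ ∑ x ∈ F, edgeDeg E x := by
    refine (card_le_card fun e he => ?_).trans card_biUnion_le
    simpa [← exists_and_left, and_left_comm, edgeDeg] using he
  rw [← card_filter_add_card_filter_not (s := E) (fun e => ∀ x ∈ F, x ∉ e)]
  exact Nat.add_le_add hforest hincident

end FeedbackVertexSets

theorem card_insert_add_card_le {V : Type*} [DecidableEq V] {S C : Finset V} (hCS : C ⊆ S)
    (a : V) : #(insert a S) + #C ≤ #S + #(C.erase a) + 1 := by
  by_cases ha : a ∈ C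
  · rw [insert_eq_of_mem (hCS ha), add_assoc, card_erase_add_one ha]
  · rw [erase_eq_of_notMem ha]
    have := card_insert_le a S
    omega

/-- A subgraph of `G` of maximum degree three with a set `sel` of selected vertices that meets all
its cycles. At each vertex `u` of `crit`, which is selected although it has degree at most two, the
subgraph carries an attached cycle of `G` with vertex set `loop u`; these cycles are pairwise
disjoint and meet the subgraph only in `u`. -/
structure Config {V : Type*} [DecidableEq V] (G : SimpleGraph V) where
  edges : Finset (Sym2 V)
  sel : Finset V
  crit : Finset V
  loop : V → Set V
  edges_subset : ↑edges ⊆ G.edgeSet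
  edgeDeg_le_three : ∀ x, edgeDeg edges x ≤ 3
  edgeDeg_le_two : ∀ x ∉ sel \ crit, edgeDeg edges x ≤ 2
  crit_subset_sel : crit ⊆ sel
  crit_subset_edgeVerts : crit ⊆ edgeVerts edges
  exists_isCycle_loop : ∀ u ∈ crit, ∃ c : G.Walk u u, c.IsCycle ∧ loop u = {x | x ∈ c.support}
  eq_of_mem_loop : ∀ u ∈ crit, ∀ x ∈ loop u, x ∈ edgeVerts edges → x = u
  pairwiseDisjoint_loop : (crit : Set V).PairwiseDisjoint loop
  isFVS : IsFVS (fromEdgeSet (edges : Set (Sym2 V))) sel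

namespace Config

variable {V : Type*} [DecidableEq V] {G : SimpleGraph V} {σ : Config G} {a b u x z : V}

/-- The vertices of the subgraph. -/
abbrev verts (σ : Config G) : Finset V := edgeVerts σ.edges

/-- The accounting invariant: the selected vertices are paid for by the vertices that any feedback
vertex set `F` has on the subgraph, by twice the excess of edges over vertices, and by the attached
cycles. -/
def Balanced (σ : Config G) : Prop :=
  ∀ F : Finset V, IsFVS G F → #σ.sel + 2 * #σ.verts ≤ #(F ∩ σ.verts) + 2 * #σ.edges + #σ.crit

theorem card_crit_le (σ : Config G) {F : Finset V} (hF : IsFVS G F) :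
    #σ.crit ≤ #{x ∈ F | edgeDeg σ.edges x ≤ 2} := by
  have hmeet : ∀ u ∈ σ.crit, ∃ y ∈ F, y ∈ σ.loop u := by
    intro u hu
    obtain ⟨c, hc, hloop⟩ := σ.exists_isCycle_loop u hu
    obtain ⟨y, hy, hyF⟩ := isFVS_iff.1 hF u c hc
    exact ⟨y, hyF, hloop ▸ hy⟩
  choose! f hfF hfloop using hmeet
  refine card_le_card_of_injOn f (fun u hu => ?_) fun u hu v hv huv => ?_
  · refine mem_coe.2 (mem_filter.2 ⟨hfF u hu, ?_⟩)
    by_cases hfu : f u ∈ σ.verts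
    · rw [σ.eq_of_mem_loop u hu _ (hfloop u hu) hfu]
      exact σ.edgeDeg_le_two u fun h => (mem_sdiff.1 h).2 hu
    · simp [edgeDeg_eq_zero_iff.2 hfu]
  · exact σ.pairwiseDisjoint_loop.elim_set hu hv (f u) (hfloop u hu) (huv ▸ hfloop v hv)

/- Eliminating the edges and the attached cycles from the invariant charges to each `x ∈ F` at most
`2 * d - 1` if it has degree `d = 3`, at most `2 * d` if `1 ≤ d ≤ 2`, and at most `1` if `d = 0`. -/
theorem Balanced.card_sel_le (hσ : σ.Balanced) {F : Finset V} (hF : IsFVS G F) :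
    #σ.sel ≤ 5 * #F := by
  have hcharge : ∀ x ∈ F, 2 * edgeDeg σ.edges x + (if edgeDeg σ.edges x ≤ 2 then 1 else 0) ≤
      5 + if x ∈ σ.verts then 1 else 0 := by
    intro x _
    have := σ.edgeDeg_le_three x
    have := edgeDeg_eq_zero_iff (E := σ.edges) (x := x)
    split_ifs <;> simp_all <;> omega
  have hsum := sum_le_sum hcharge
  simp only [sum_add_distrib, ← mul_sum, sum_const, smul_eq_mul, sum_boole, Nat.cast_id,
    filter_mem_eq_inter] at hsum
  have hedges : #σ.edges ≤ #(σ.verts \ F) + ∑ x ∈ F, edgeDeg σ.edges x :=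
    hF.card_edges_le σ.edges_subset
  have hverts : #(σ.verts \ F) + #(F ∩ σ.verts) = #σ.verts := by
    rw [inter_comm, card_sdiff_add_card_inter]
  have := hσ F hF
  have := σ.card_crit_le hF
  omega

/-- `z` is the vertex `u` of the subgraph, or it lies on the cycle attached at `u`. -/
def Owns (σ : Config G) (u z : V) : Prop :=
  u ∈ σ.verts ∧ z = u ∨ u ∈ σ.crit ∧ z ∈ σ.loop u

theorem owns_self (hx : x ∈ σ.verts) : σ.Owns x x := Or.inl ⟨hx, rfl⟩

theorem Owns.mem_verts (h : σ.Owns u z) : u ∈ σ.verts :=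
  h.elim And.left fun h => σ.crit_subset_edgeVerts h.1

theorem Owns.eq_of_mem_verts (h : σ.Owns u z) (hz : z ∈ σ.verts) : z = u :=
  h.elim And.right fun h => σ.eq_of_mem_loop u h.1 z h.2 hz

theorem Owns.unique {u' : V} (h : σ.Owns u z) (h' : σ.Owns u' z) : u = u' := by
  rcases h with ⟨hu, rfl⟩ | ⟨hu, hz⟩
  · exact h'.eq_of_mem_verts hu
  · rcases h' with ⟨hu', rfl⟩ | ⟨hu', hz'⟩
    · exact (σ.eq_of_mem_loop u hu z hz hu').symm
    · exact σ.pairwiseDisjoint_loop.elim_set hu hu' z hz hz'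

theorem Owns.exists_walk (h : σ.Owns u z) : ∃ w : G.Walk u z, ∀ y ∈ w.support, σ.Owns u y := by
  rcases h with ⟨hu, rfl⟩ | ⟨hu, hz⟩
  · exact ⟨Walk.nil, by simpa using owns_self hu⟩
  · obtain ⟨c, -, hloop⟩ := σ.exists_isCycle_loop u hu
    rw [hloop] at hz
    refine ⟨c.takeUntil z hz, fun y hy => Or.inr ⟨hu, ?_⟩⟩
    rw [hloop]
    exact c.support_takeUntil_subset_support hz hy

theorem notMem_edges_of_owns_imp_eq {w : G.Walk x z}
    (hw : ∀ y ∈ w.support, ∀ u, σ.Owns u y → u = a) : ∀ e ∈ w.edges, e ∉ σ.edges := by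
  intro e he heσ
  induction e using Sym2.ind with | _ y y' =>
  have hy := hw y (w.fst_mem_support_of_mem_edges he) y
    (owns_self (mem_edgeVerts.2 ⟨_, heσ, by simp⟩))
  have hy' := hw y' (w.snd_mem_support_of_mem_edges he) y'
    (owns_self (mem_edgeVerts.2 ⟨_, heσ, by simp⟩))
  exact (w.adj_of_mem_edges he).ne (hy.trans hy'.symm)

/-- The vertices of the subgraph at which a further edge may be added to it. -/
def IsLinkPoint (σ : Config G) (a : V) : Prop := a ∈ σ.verts ∧ edgeDeg σ.edges a ≤ 2

theorem Owns.isLinkPoint (h : σ.Owns u z) (hz : z ∉ σ.sel) : σ.IsLinkPoint u := by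
  refine ⟨h.mem_verts, σ.edgeDeg_le_two u fun hu => ?_⟩
  rw [mem_sdiff] at hu
  rcases h with ⟨-, rfl⟩ | ⟨hcrit, -⟩
  exacts [hz hu.1, hu.2 hcrit]

section Ears

/-- A walk by which the subgraph can be extended: it joins two link points, leaves the subgraph in
between, and meets no attached cycles except those at its ends. -/
structure IsEar (σ : Config G) (p : G.Walk a b) : Prop where
  ne : a ≠ b
  isLinkPoint_start : σ.IsLinkPoint a
  isLinkPoint_finish : σ.IsLinkPoint b
  eq_or_eq_of_owns : ∀ z ∈ p.support, ∀ u, σ.Owns u z → u = a ∨ u = b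
  notMem_edges : ∀ e ∈ p.edges, e ∉ σ.edges

variable {p : G.Walk a b}

theorem IsEar.bypass (hp : σ.IsEar p) : σ.IsEar p.bypass where
  ne := hp.ne
  isLinkPoint_start := hp.isLinkPoint_start
  isLinkPoint_finish := hp.isLinkPoint_finish
  eq_or_eq_of_owns z hz := hp.eq_or_eq_of_owns z (p.support_bypass_subset_support hz)
  notMem_edges e he := hp.notMem_edges e (p.edges_bypass_subset_edges he)

theorem IsEar.eq_or_eq_of_mem_verts (hp : σ.IsEar p) (hz : z ∈ p.support) (hzσ : z ∈ σ.verts) :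
    z = a ∨ z = b :=
  hp.eq_or_eq_of_owns z hz z (owns_self hzσ)

theorem IsEar.edgeVerts_union (hp : σ.IsEar p) :
    edgeVerts (σ.edges ∪ p.edges.toFinset) = σ.verts ∪ p.support.toFinset := by
  rw [DelayedFVS.edgeVerts_union, edgeVerts_edges fun hnil => hp.ne hnil.eq]

theorem IsEar.edgeDeg_union_le (hp : σ.IsEar p) (hpath : p.IsPath) (hxa : x ≠ a) (hxb : x ≠ b) :
    edgeDeg (σ.edges ∪ p.edges.toFinset) x ≤ max (edgeDeg σ.edges x) 2 := by
  refine (edgeDeg_union_le_max fun hx hxp => ?_).trans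
    (max_le_max le_rfl (edgeDeg_path_le_two hpath x))
  rw [edgeVerts_edges fun hnil => hp.ne hnil.eq, List.mem_toFinset] at hxp
  exact (hp.eq_or_eq_of_mem_verts hxp hx).elim hxa hxb

theorem IsEar.edgeDeg_union_le_three (hp : σ.IsEar p) (hpath : p.IsPath) (x : V) :
    edgeDeg (σ.edges ∪ p.edges.toFinset) x ≤ 3 := by
  by_cases hx : x = a ∨ x = b
  · have hdeg : edgeDeg σ.edges x ≤ 2 := by
      rcases hx with rfl | rfl
      exacts [hp.isLinkPoint_start.2, hp.isLinkPoint_finish.2]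
    exact DelayedFVS.edgeDeg_union_le.trans
      (Nat.add_le_add hdeg (edgeDeg_path_endpoint_le_one hpath hx))
  · push Not at hx
    exact (hp.edgeDeg_union_le hpath hx.1 hx.2).trans (max_le (σ.edgeDeg_le_three x) (by simp))

/-- The extension of the subgraph by an ear, whose ends are selected; the cycles attached at them
are given up. -/
def addEar (σ : Config G) (hp : σ.IsEar p) (hpath : p.IsPath) : Config G where
  edges := σ.edges ∪ p.edges.toFinset
  sel := insert a (insert b σ.sel)
  crit := (σ.crit.erase a).erase b
  loop := σ.loop
  edges_subset e he := (mem_union.1 he).elim (σ.edges_subset ·)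
    fun he => p.edges_subset_edgeSet (List.mem_toFinset.1 he)
  edgeDeg_le_three := hp.edgeDeg_union_le_three hpath
  edgeDeg_le_two x hx := by
    have hx : (x ≠ a ∧ x ≠ b) ∧ x ∉ σ.sel \ σ.crit := by
      simp only [mem_sdiff, mem_insert, mem_erase] at hx ⊢
      tauto
    exact (hp.edgeDeg_union_le hpath hx.1.1 hx.1.2).trans
      (max_le (σ.edgeDeg_le_two x hx.2) le_rfl)
  crit_subset_sel := (erase_subset _ _).trans <| (erase_subset _ _).trans <|
    σ.crit_subset_sel.trans <| (subset_insert _ _).trans (subset_insert _ _)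
  crit_subset_edgeVerts := by
    rw [hp.edgeVerts_union]
    exact (erase_subset _ _).trans <| (erase_subset _ _).trans <|
      σ.crit_subset_edgeVerts.trans subset_union_left
  exists_isCycle_loop u hu := σ.exists_isCycle_loop u (mem_of_mem_erase (mem_of_mem_erase hu))
  eq_of_mem_loop u hu x hx hxτ := by
    simp only [mem_erase] at hu
    rw [hp.edgeVerts_union, mem_union, List.mem_toFinset] at hxτ
    rcases hxτ with hxσ | hxp
    · exact σ.eq_of_mem_loop u hu.2.2 x hx hxσ
    · exact ((hp.eq_or_eq_of_owns x hxp u (Or.inr ⟨hu.2.2, hx⟩)).elim hu.2.1 hu.1).elim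
  pairwiseDisjoint_loop := σ.pairwiseDisjoint_loop.subset fun u hu =>
    mem_of_mem_erase (mem_of_mem_erase hu)
  isFVS := by
    refine (σ.isFVS.union_path hpath fun x hx hxσ => hp.eq_or_eq_of_mem_verts hx hxσ).mono ?_
    rw [coe_insert]
    exact Set.insert_subset_insert (coe_subset.2 (subset_insert b σ.sel))

variable (hp : σ.IsEar p) (hpath : p.IsPath)
include hp hpath

theorem verts_addEar : (σ.addEar hp hpath).verts = σ.verts ∪ p.support.toFinset :=
  hp.edgeVerts_union

theorem card_edges_addEar : #(σ.addEar hp hpath).edges = #σ.edges + p.length := by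
  rw [← card_edges_of_isTrail hpath.isTrail]
  exact card_union_of_disjoint
    (disjoint_right.2 fun e he => hp.notMem_edges e (List.mem_toFinset.1 he))

theorem card_verts_addEar : #(σ.addEar hp hpath).verts + 1 = #σ.verts + p.length := by
  have hinter : σ.verts ∩ p.support.toFinset = {a, b} := by
    ext z
    simp only [mem_inter, List.mem_toFinset, mem_insert, mem_singleton]
    refine ⟨fun hz => hp.eq_or_eq_of_mem_verts hz.2 hz.1, ?_⟩
    rintro (rfl | rfl)
    exacts [⟨hp.isLinkPoint_start.1, p.start_mem_support⟩,
      ⟨hp.isLinkPoint_finish.1, p.end_mem_support⟩]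
  have := card_union_add_card_inter σ.verts p.support.toFinset
  rw [hinter, card_pair hp.ne, card_support_of_isPath hpath] at this
  rw [verts_addEar]
  omega

theorem card_inter_verts_le_addEar (F : Finset V) :
    #(F ∩ σ.verts) ≤ #(F ∩ (σ.addEar hp hpath).verts) := by
  rw [verts_addEar]
  exact card_le_card (inter_subset_inter_left subset_union_left)

theorem Balanced.addEar (hσ : σ.Balanced) : (σ.addEar hp hpath).Balanced := by
  intro F hF
  have hsel :
      #(insert a (insert b σ.sel)) + #σ.crit ≤ #σ.sel + #((σ.crit.erase a).erase b) + 2 := by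
    have hb := card_insert_add_card_le σ.crit_subset_sel b
    have ha := card_insert_add_card_le
      (((erase_subset b _).trans σ.crit_subset_sel).trans (subset_insert b _)) a
    rw [erase_right_comm] at ha
    omega
  have := hσ F hF
  have := card_inter_verts_le_addEar hp hpath F
  have := card_edges_addEar hp hpath
  have := card_verts_addEar hp hpath
  change #(insert a (insert b σ.sel)) + _ ≤ _ + #((σ.crit.erase a).erase b)
  omega

end Ears

section Cycles

variable {c : G.Walk x x}

theorem edgeDeg_union_cycle_le (hc : c.IsCycle) (hdisj : ∀ z ∈ c.support, z ∉ σ.verts) (z : V) :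
    edgeDeg (σ.edges ∪ c.edges.toFinset) z ≤ max (edgeDeg σ.edges z) 2 := by
  refine (edgeDeg_union_le_max fun hz hzc => ?_).trans
    (max_le_max le_rfl (edgeDeg_cycle_le_two hc z))
  rw [edgeVerts_edges hc.not_nil, List.mem_toFinset] at hzc
  exact hdisj z hzc hz

/-- The extension of the subgraph by a disjoint cycle through `x`, where `x` is selected. The cycle
attached at `a`, if any, is given up; the new cycle may meet it. -/
def addCycle (σ : Config G) (a : V) (hc : c.IsCycle) (hdisj : ∀ z ∈ c.support, z ∉ σ.verts)
    (hown : ∀ z ∈ c.support, ∀ u, σ.Owns u z → u = a) : Config G where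
  edges := σ.edges ∪ c.edges.toFinset
  sel := insert x σ.sel
  crit := σ.crit.erase a
  loop := σ.loop
  edges_subset e he := (mem_union.1 he).elim (σ.edges_subset ·)
    fun he => c.edges_subset_edgeSet (List.mem_toFinset.1 he)
  edgeDeg_le_three z := (edgeDeg_union_cycle_le hc hdisj z).trans
    (max_le (σ.edgeDeg_le_three z) (by simp))
  edgeDeg_le_two z hz := by
    have hz : z ∉ σ.sel \ σ.crit := by
      simp only [mem_sdiff, mem_insert, mem_erase] at hz ⊢
      tauto
    exact (edgeDeg_union_cycle_le hc hdisj z).trans (max_le (σ.edgeDeg_le_two z hz) le_rfl)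
  crit_subset_sel := (erase_subset _ _).trans (σ.crit_subset_sel.trans (subset_insert _ _))
  crit_subset_edgeVerts := by
    rw [edgeVerts_union]
    exact (erase_subset _ _).trans (σ.crit_subset_edgeVerts.trans subset_union_left)
  exists_isCycle_loop u hu := σ.exists_isCycle_loop u (mem_of_mem_erase hu)
  eq_of_mem_loop u hu z hz hzτ := by
    rw [mem_erase] at hu
    rw [edgeVerts_union, edgeVerts_edges hc.not_nil, mem_union, List.mem_toFinset] at hzτ
    rcases hzτ with hzσ | hzc
    · exact σ.eq_of_mem_loop u hu.2 z hz hzσ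
    · exact (hu.1 (hown z hzc u (Or.inr ⟨hu.2, hz⟩))).elim
  pairwiseDisjoint_loop := σ.pairwiseDisjoint_loop.subset fun u hu => mem_of_mem_erase hu
  isFVS := by
    rw [coe_insert]
    exact σ.isFVS.union_cycle hc hdisj

variable (hc : c.IsCycle) (hdisj : ∀ z ∈ c.support, z ∉ σ.verts)
  (hown : ∀ z ∈ c.support, ∀ u, σ.Owns u z → u = a)
include hc hdisj hown

theorem verts_addCycle :
    (σ.addCycle a hc hdisj hown).verts = σ.verts ∪ c.support.toFinset := by
  rw [← edgeVerts_edges hc.not_nil]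
  exact edgeVerts_union

theorem card_edges_addCycle :
    #(σ.addCycle a hc hdisj hown).edges = #σ.edges + c.length := by
  rw [← card_edges_of_isTrail hc.isTrail]
  refine card_union_of_disjoint (disjoint_left.2 fun e he hec => ?_)
  induction e using Sym2.ind with | _ y z =>
  exact hdisj y (c.fst_mem_support_of_mem_edges (List.mem_toFinset.1 hec))
    (mem_edgeVerts.2 ⟨_, he, by simp⟩)

theorem card_verts_addCycle :
    #(σ.addCycle a hc hdisj hown).verts = #σ.verts + c.length := by
  rw [verts_addCycle, ← card_support_of_isCycle hc]
  exact card_union_of_disjoint (disjoint_right.2 fun z hz => hdisj z (List.mem_toFinset.1 hz))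

theorem card_inter_verts_lt_addCycle {F : Finset V} (hF : IsFVS G F) :
    #(F ∩ σ.verts) < #(F ∩ (σ.addCycle a hc hdisj hown).verts) := by
  obtain ⟨y, hy, hyF⟩ := isFVS_iff.1 hF x c hc
  rw [verts_addCycle, inter_union_distrib_left]
  refine card_lt_card (Finset.ssubset_iff_subset_ne.2 ⟨subset_union_left, fun heq => ?_⟩)
  have : y ∈ F ∩ σ.verts := heq ▸ mem_union_right _ (mem_inter.2 ⟨hyF, List.mem_toFinset.2 hy⟩)
  exact hdisj y hy (mem_inter.1 this).2

end Cycles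

/-- The selection of the vertex `a` of the subgraph, at which a cycle is attached. -/
def attach (σ : Config G) {c : G.Walk a a} (ha : a ∈ σ.verts) (has : a ∉ σ.sel) (hc : c.IsCycle)
    (hown : ∀ z ∈ c.support, ∀ u, σ.Owns u z → u = a) : Config G where
  edges := σ.edges
  sel := insert a σ.sel
  crit := insert a σ.crit
  loop := Function.update σ.loop a {z | z ∈ c.support}
  edges_subset := σ.edges_subset
  edgeDeg_le_three := σ.edgeDeg_le_three
  edgeDeg_le_two z hz := σ.edgeDeg_le_two z fun h => hz <| by
    simp only [mem_sdiff, mem_insert, not_or] at h ⊢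
    exact ⟨Or.inr h.1, fun hza => has (hza ▸ h.1), h.2⟩
  crit_subset_sel := insert_subset_insert a σ.crit_subset_sel
  crit_subset_edgeVerts := insert_subset ha σ.crit_subset_edgeVerts
  exists_isCycle_loop u hu := by
    by_cases hua : u = a
    · subst hua
      exact ⟨c, hc, Function.update_self _ _ _⟩
    · rw [Function.update_of_ne hua]
      exact σ.exists_isCycle_loop u (mem_of_mem_insert_of_ne hu hua)
  eq_of_mem_loop u hu z hz hzσ := by
    by_cases hua : u = a
    · subst hua
      rw [Function.update_self] at hz
      exact hown z hz z (owns_self hzσ)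
    · rw [Function.update_of_ne hua] at hz
      exact σ.eq_of_mem_loop u (mem_of_mem_insert_of_ne hu hua) z hz hzσ
  pairwiseDisjoint_loop := by
    have hac : a ∉ σ.crit := fun h => has (σ.crit_subset_sel h)
    rw [coe_insert, Set.pairwiseDisjoint_insert_of_notMem (mod_cast hac)]
    refine ⟨fun u hu v hv huv => ?_, fun u hu => ?_⟩
    · have hua : u ≠ a := fun h => hac (h ▸ hu)
      have hva : v ≠ a := fun h => hac (h ▸ hv)
      simpa only [Function.onFun, Function.update_of_ne hua, Function.update_of_ne hva] using
        σ.pairwiseDisjoint_loop hu hv huv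
    · have hua : u ≠ a := fun h => hac (h ▸ hu)
      rw [Function.update_self, Function.update_of_ne hua]
      exact Set.disjoint_left.2 fun z hzc hzu => hua (hown z hzc u (Or.inr ⟨hu, hzu⟩))
  isFVS := σ.isFVS.mono (coe_subset.2 (subset_insert a σ.sel))

theorem Balanced.attach {c : G.Walk a a} (hσ : σ.Balanced) (ha : a ∈ σ.verts) (has : a ∉ σ.sel)
    (hc : c.IsCycle) (hown : ∀ z ∈ c.support, ∀ u, σ.Owns u z → u = a) :
    (σ.attach ha has hc hown).Balanced := by
  intro F hF
  have := hσ F hF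
  change #(insert a σ.sel) + 2 * #σ.verts ≤ #(F ∩ σ.verts) + 2 * #σ.edges + #(insert a σ.crit)
  rw [card_insert_of_notMem has, card_insert_of_notMem fun h => has (σ.crit_subset_sel h)]
  omega

/-- The configuration on the empty subgraph. -/
def empty (G : SimpleGraph V) : Config G where
  edges := ∅
  sel := ∅
  crit := ∅
  loop := fun _ => ∅
  edges_subset := by simp
  edgeDeg_le_three := by simp [edgeDeg]
  edgeDeg_le_two := by simp [edgeDeg]
  crit_subset_sel := subset_rfl
  crit_subset_edgeVerts := empty_subset _
  exists_isCycle_loop := by simp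
  eq_of_mem_loop := by simp
  pairwiseDisjoint_loop := by simp
  isFVS := isFVS_edgeVerts

theorem balanced_empty (G : SimpleGraph V) : (empty G).Balanced := fun F _ => by
  simp [empty, edgeVerts]

/-- A configuration of a graph as one of a larger graph. -/
def mono {G' : SimpleGraph V} (σ : Config G) (hGG' : G ≤ G') : Config G' where
  edges := σ.edges
  sel := σ.sel
  crit := σ.crit
  loop := σ.loop
  edges_subset := σ.edges_subset.trans (edgeSet_mono hGG')
  edgeDeg_le_three := σ.edgeDeg_le_three
  edgeDeg_le_two := σ.edgeDeg_le_two
  crit_subset_sel := σ.crit_subset_sel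
  crit_subset_edgeVerts := σ.crit_subset_edgeVerts
  exists_isCycle_loop u hu := by
    obtain ⟨c, hc, hloop⟩ := σ.exists_isCycle_loop u hu
    exact ⟨c.mapLe hGG', hc.mapLe hGG', by simpa using hloop⟩
  eq_of_mem_loop := σ.eq_of_mem_loop
  pairwiseDisjoint_loop := σ.pairwiseDisjoint_loop
  isFVS := σ.isFVS

theorem Balanced.mono {G' : SimpleGraph V} (hσ : σ.Balanced) (hGG' : G ≤ G') :
    (σ.mono hGG').Balanced :=
  fun F hF => hσ F (hF.anti hGG')

section Augmentation

/-- No walk is an ear of the configuration. -/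
def EarFree (σ : Config G) : Prop :=
  ∀ (a b : V) (p : G.Walk a b), ¬ σ.IsEar p

/-- `x` can be reached from `a` off the subgraph and off all attached cycles except that at `a`. -/
def Reach (σ : Config G) (a x : V) : Prop :=
  ∃ w : G.Walk a x, ∀ z ∈ w.support, ∀ u, σ.Owns u z → u = a

theorem Owns.reach (h : σ.Owns u z) : σ.Reach u z := by
  obtain ⟨w, hw⟩ := h.exists_walk
  exact ⟨w, fun y hy v hv => hv.unique (hw y hy)⟩

theorem Reach.eq_of_owns (h : σ.Reach a x) (hu : σ.Owns u x) : u = a :=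
  h.choose_spec x h.choose.end_mem_support u hu

theorem Reach.eq_of_mem_verts (h : σ.Reach a x) (hx : x ∈ σ.verts) : x = a :=
  h.eq_of_owns (owns_self hx)

variable {y : V}

theorem Reach.step (hσ : σ.EarFree) (ha : σ.IsLinkPoint a) (h : σ.Reach a x) (hxy : G.Adj x y)
    (hE : s(x, y) ∉ σ.edges) (hy : y ∉ σ.sel) : σ.Reach a y := by
  obtain ⟨w, hw⟩ := h
  by_cases hya : ∀ b, σ.Owns b y → b = a
  · refine ⟨w.concat hxy, fun z hz => ?_⟩
    rw [Walk.support_concat, List.mem_append, List.mem_singleton] at hz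
    rcases hz with hz | rfl
    exacts [hw z hz, hya]
  push Not at hya
  obtain ⟨b, hby, hba⟩ := hya
  obtain ⟨w', hw'⟩ := hby.exists_walk
  have hw'b : ∀ z ∈ w'.support, ∀ u, σ.Owns u z → u = b := fun z hz u hu => hu.unique (hw' z hz)
  refine absurd ?_ (hσ a b (w.append (Walk.cons hxy w'.reverse)))
  refine ⟨hba.symm, ha, hby.isLinkPoint hy, fun z hz u hu => ?_, fun e he => ?_⟩
  · simp only [Walk.mem_support_append_iff, Walk.support_cons, Walk.support_reverse, List.mem_cons,
      List.mem_reverse] at hz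
    rcases hz with hz | rfl | hz
    exacts [Or.inl (hw z hz u hu), Or.inl (hw z w.end_mem_support u hu), Or.inr (hw'b z hz u hu)]
  · simp only [Walk.edges_append, Walk.edges_cons, Walk.edges_reverse, List.mem_append,
      List.mem_cons, List.mem_reverse] at he
    rcases he with he | rfl | he
    exacts [notMem_edges_of_owns_imp_eq hw e he, hE, notMem_edges_of_owns_imp_eq hw'b e he]

theorem Reach.of_mem_support_path (hσ : σ.EarFree) (ha : σ.IsLinkPoint a) (h : σ.Reach a x)
    {p : G.Walk x y} (hp : p.IsPath) (hpσ : ∀ z ∈ p.support, z ∉ σ.sel)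
    (hpa : a ∈ p.support → y = a) : ∀ z ∈ p.support, σ.Reach a z := by
  induction p with
  | nil => simpa using h
  | @cons x x' y hadj p ih =>
    rw [Walk.support_cons, List.mem_cons] at hpa
    simp only [Walk.support_cons, List.forall_mem_cons] at hpσ ⊢
    obtain ⟨hp, hxp⟩ := (Walk.cons_isPath_iff _ _).1 hp
    have hE : s(x, x') ∉ σ.edges := by
      intro hE
      have hxa : x = a := h.eq_of_mem_verts (mem_edgeVerts.2 ⟨_, hE, by simp⟩)
      have hya : y = a := hpa (Or.inl hxa.symm)
      exact hxp (hxa.trans hya.symm ▸ p.end_mem_support)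
    have hx' : σ.Reach a x' := h.step hσ ha hadj hE (hpσ.2 x' p.start_mem_support)
    exact ⟨h, ih hx' hp hpσ.2 fun hap => hpa (Or.inr hap)⟩

theorem EarFree.edges_subset_of_isPath (hσ : σ.EarFree) {p : G.Walk x y} (hp : p.IsPath)
    (hpσ : ∀ z ∈ p.support, z ∉ σ.sel) (hx : x ∈ σ.verts) (hy : y ∈ σ.verts) :
    ∀ e ∈ p.edges, e ∈ σ.edges := by
  induction p with
  | nil => simp
  | @cons x x' y hadj p ih =>
    simp only [Walk.support_cons, List.forall_mem_cons, Walk.edges_cons] at hpσ ⊢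
    obtain ⟨hp, hxp⟩ := (Walk.cons_isPath_iff _ _).1 hp
    by_cases hE : s(x, x') ∈ σ.edges
    · exact ⟨hE, ih hp hpσ.2 (mem_edgeVerts.2 ⟨_, hE, by simp⟩) hy⟩
    · have hlink : σ.IsLinkPoint x := (owns_self hx).isLinkPoint hpσ.1
      have hx' : σ.Reach x x' :=
        (owns_self hx).reach.step hσ hlink hadj hE (hpσ.2 x' p.start_mem_support)
      have hreach := hx'.of_mem_support_path hσ hlink hp hpσ.2 (fun hxp' => absurd hxp' hxp)
      have hyx : y = x := (hreach y p.end_mem_support).eq_of_mem_verts hy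
      exact absurd (hyx ▸ p.end_mem_support) hxp

theorem Owns.reach_of_isCycle (hσ : σ.EarFree) {c : G.Walk x x} (hc : c.IsCycle)
    (hcσ : ∀ z ∈ c.support, z ∉ σ.sel) (hx : σ.Owns a x) : ∀ z ∈ c.support, σ.Reach a z := by
  cases c with
  | nil => exact absurd rfl hc.ne_nil
  | @cons _ x' _ hadj p =>
    have hp := ((Walk.cons_isCycle_iff _ _).1 hc).1
    have hpσ : ∀ z ∈ p.support, z ∉ σ.sel := fun z hz => hcσ z (List.mem_cons_of_mem x hz)
    have hlink : σ.IsLinkPoint a := hx.isLinkPoint (hcσ x (by simp))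
    have hE : s(x, x') ∉ σ.edges := by
      intro hE
      have hpE := hσ.edges_subset_of_isPath hp hpσ (mem_edgeVerts.2 ⟨_, hE, by simp⟩)
        (mem_edgeVerts.2 ⟨_, hE, by simp⟩)
      obtain ⟨y, hy, hyσ⟩ := σ.isFVS.exists_mem_support hc
        (by simpa only [Walk.edges_cons, List.forall_mem_cons] using ⟨hE, hpE⟩)
      exact hcσ y hy hyσ
    have hx' : σ.Reach a x' := hx.reach.step hσ hlink hadj hE (hpσ x' p.start_mem_support)
    have hpa : a ∈ p.support → x = a := fun ha =>
      hx.elim And.right fun h => absurd (σ.crit_subset_sel h.1) (hpσ a ha)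
    simpa only [Walk.support_cons, List.forall_mem_cons] using
      ⟨hx.reach, hx'.of_mem_support_path hσ hlink hp hpσ hpa⟩

/-- `τ` is balanced, selects at least what `σ` selects, and has made progress. -/
structure Improves (τ σ : Config G) : Prop where
  balanced : τ.Balanced
  sel_subset : σ.sel ⊆ τ.sel
  lt : #σ.edges + #σ.sel < #τ.edges + #τ.sel

theorem IsEar.exists_improves {p : G.Walk a b} (hp : σ.IsEar p) (hσ : σ.Balanced) :
    ∃ τ : Config G, τ.Improves σ := by
  have hpath := p.bypass_isPath
  have hsub : σ.sel ⊆ (σ.addEar hp.bypass hpath).sel :=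
    (subset_insert _ _).trans (subset_insert _ _)
  refine ⟨σ.addEar hp.bypass hpath, hσ.addEar hp.bypass hpath, hsub, ?_⟩
  have hlen : p.bypass.length ≠ 0 := fun h => hp.ne (Walk.eq_of_length_eq_zero h)
  have := card_edges_addEar hp.bypass hpath
  have := card_le_card hsub
  omega

theorem Balanced.exists_improves_of_disjoint (hσ : σ.Balanced) {c : G.Walk x x} (hc : c.IsCycle)
    (hcσ : ∀ z ∈ c.support, ∀ u, ¬ σ.Owns u z) : ∃ τ : Config G, τ.Improves σ := by
  have hdisj : ∀ z ∈ c.support, z ∉ σ.verts := fun z hz hzσ => hcσ z hz z (owns_self hzσ)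
  have hown : ∀ z ∈ c.support, ∀ u, σ.Owns u z → u = x := fun z hz u hu => absurd hu (hcσ z hz u)
  have hsub : σ.sel ⊆ (σ.addCycle x hc hdisj hown).sel := subset_insert _ _
  have hedges := card_edges_addCycle hc hdisj hown
  refine ⟨σ.addCycle x hc hdisj hown, fun F hF => ?_, hsub, ?_⟩
  · have hcrit : #(σ.crit.erase x) = #σ.crit := by
      rw [erase_eq_of_notMem fun h => hdisj x c.start_mem_support (σ.crit_subset_edgeVerts h)]
    have := hσ F hF
    have := card_verts_addCycle hc hdisj hown
    have := card_inter_verts_lt_addCycle hc hdisj hown hF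
    have := card_insert_le x σ.sel
    change #(insert x σ.sel) + _ ≤ _ + #(σ.crit.erase x)
    omega
  · have := hc.three_le_length
    have := card_le_card hsub
    omega

theorem Owns.exists_isEar_addCycle (hx : σ.Owns a x) (ha : σ.IsLinkPoint a) {c : G.Walk x x}
    (hc : c.IsCycle) (hdisj : ∀ z ∈ c.support, z ∉ σ.verts)
    (hown : ∀ z ∈ c.support, ∀ u, σ.Owns u z → u = a) :
    ∃ w ∈ c.support, ∃ q : G.Walk a w, (σ.addCycle a hc hdisj hown).IsEar q := by
  obtain ⟨p, hp⟩ := hx.exists_walk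
  obtain ⟨w, hwc, hwp, hfirst⟩ := p.exists_mem_support_forall_mem_support_imp_eq c.support.toFinset
    ⟨x, mem_filter.2 ⟨by simp, p.end_mem_support⟩⟩
  simp only [List.mem_toFinset] at hwc hfirst
  have hq : ∀ z ∈ (p.takeUntil w hwp).support, σ.Owns a z := fun z hz =>
    hp z (p.support_takeUntil_subset_support hwp hz)
  have hqa : ∀ z ∈ (p.takeUntil w hwp).support, ∀ u, σ.Owns u z → u = a := fun z hz u hu =>
    hu.unique (hq z hz)
  have hwσ : edgeDeg σ.edges w = 0 := edgeDeg_eq_zero_iff.2 (hdisj w hwc)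
  refine ⟨w, hwc, p.takeUntil w hwp, ?_, ⟨?_, ?_⟩, ⟨?_, ?_⟩, fun z hz u hu => ?_,
    fun e he heτ => ?_⟩
  · exact fun haw => hdisj w hwc (haw ▸ ha.1)
  · rw [verts_addCycle]
    exact mem_union_left _ ha.1
  · exact (edgeDeg_union_cycle_le hc hdisj a).trans (max_le ha.2 le_rfl)
  · rw [verts_addCycle]
    exact mem_union_right _ (List.mem_toFinset.2 hwc)
  · exact (edgeDeg_union_cycle_le hc hdisj w).trans (max_le (by simp [hwσ]) le_rfl)
  · rcases hu with ⟨hu, rfl⟩ | ⟨hu, hzu⟩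
    · rw [verts_addCycle, mem_union, List.mem_toFinset] at hu
      exact hu.imp (fun hzσ => hqa z hz z (owns_self hzσ)) fun hzc => hfirst z hzc hz
    · exact Or.inl (hqa z hz u (Or.inr ⟨mem_of_mem_erase hu, hzu⟩))
  · rcases mem_union.1 heτ with heσ | hec
    · exact notMem_edges_of_owns_imp_eq hqa e he heσ
    · rw [List.mem_toFinset] at hec
      induction e using Sym2.ind with | _ y z =>
      have hy := hfirst y (c.fst_mem_support_of_mem_edges hec)
        (Walk.fst_mem_support_of_mem_edges _ he)
      have hz := hfirst z (c.snd_mem_support_of_mem_edges hec)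
        (Walk.snd_mem_support_of_mem_edges _ he)
      exact (c.adj_of_mem_edges hec).ne (hy.trans hz.symm)

/- The new cycle replaces the one attached at `a`: adding it together with an ear from `a` costs two
further vertices, namely `w` and `x`, as `a` is already selected. -/
theorem Balanced.exists_improves_of_crit (hσ : σ.Balanced) (ha : a ∈ σ.crit) (hx : σ.Owns a x)
    {c : G.Walk x x} (hc : c.IsCycle) (hac : a ∉ c.support)
    (hown : ∀ z ∈ c.support, ∀ u, σ.Owns u z → u = a) : ∃ τ : Config G, τ.Improves σ := by
  have hdisj : ∀ z ∈ c.support, z ∉ σ.verts := fun z hz hzσ =>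
    hac (hown z hz z (owns_self hzσ) ▸ hz)
  have haσ : a ∈ σ.verts := σ.crit_subset_edgeVerts ha
  have hlink : σ.IsLinkPoint a := ⟨haσ, σ.edgeDeg_le_two a fun h => (mem_sdiff.1 h).2 ha⟩
  obtain ⟨w, hwc, q, hq⟩ := hx.exists_isEar_addCycle hlink hc hdisj hown
  have hpath := q.bypass_isPath
  set ρ := (σ.addCycle a hc hdisj hown).addEar hq.bypass hpath
  have hselρ : ρ.sel = insert a (insert w (insert x σ.sel)) := rfl
  have hcritρ : ρ.crit = ((σ.crit.erase a).erase a).erase w := rfl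
  have hsub : σ.sel ⊆ ρ.sel :=
    (subset_insert _ _).trans <| (subset_insert _ _).trans (subset_insert _ _)
  have hsel : #ρ.sel ≤ #σ.sel + 2 := by
    rw [hselρ, insert_eq_of_mem (mem_insert_of_mem (mem_insert_of_mem (σ.crit_subset_sel ha)))]
    have := card_insert_le w (insert x σ.sel)
    have := card_insert_le x σ.sel
    omega
  have hcrit : #ρ.crit + 1 = #σ.crit := by
    have hw : w ∉ σ.crit := fun h => hdisj w hwc (σ.crit_subset_edgeVerts h)
    rw [hcritρ, erase_idem, erase_eq_of_notMem fun h => hw (mem_of_mem_erase h),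
      card_erase_add_one ha]
  have hedges : #ρ.edges = #σ.edges + c.length + q.bypass.length := by
    rw [card_edges_addEar, card_edges_addCycle]
  have hverts : #ρ.verts + 1 = #σ.verts + c.length + q.bypass.length := by
    rw [card_verts_addEar, card_verts_addCycle]
  refine ⟨ρ, fun F hF => ?_, hsub, ?_⟩
  · have := hσ F hF
    have := card_inter_verts_lt_addCycle hc hdisj hown hF
    have : _ ≤ #(F ∩ ρ.verts) := card_inter_verts_le_addEar hq.bypass hpath F
    omega
  · have := hc.three_le_length
    have := card_le_card hsub
    omega

theorem Balanced.exists_improves (hσ : σ.Balanced) (hsel : ¬ IsFVS G σ.sel) :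
    ∃ τ : Config G, τ.Improves σ := by
  by_cases hear : σ.EarFree
  swap
  · unfold EarFree at hear
    push Not at hear
    obtain ⟨a, b, p, hp⟩ := hear
    exact hp.exists_improves hσ
  rw [isFVS_iff] at hsel
  push Not at hsel
  obtain ⟨v, c, hc, hcσ⟩ := hsel
  by_cases hfree : ∀ z ∈ c.support, ∀ u, ¬ σ.Owns u z
  · exact hσ.exists_improves_of_disjoint hc hfree
  push Not at hfree
  obtain ⟨x, hxc, a, hx⟩ := hfree
  have hrot := hc.rotate hxc
  have hrotσ : ∀ z ∈ (c.rotate x hxc).support, z ∉ σ.sel := fun z hz =>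
    hcσ z ((c.mem_support_rotate_iff x hxc).1 hz)
  have hown : ∀ z ∈ (c.rotate x hxc).support, ∀ u, σ.Owns u z → u = a := fun z hz _ hu =>
    (hx.reach_of_isCycle hear hrot hrotσ z hz).eq_of_owns hu
  rcases hx with ⟨ha, rfl⟩ | ⟨ha, hxa⟩
  · have hτ := hσ.attach ha (hcσ x hxc) hrot hown
    refine ⟨_, hτ, subset_insert _ _, ?_⟩
    change #σ.edges + #σ.sel < #σ.edges + #(insert x σ.sel)
    rw [card_insert_of_notMem (hcσ x hxc)]
    omega
  · exact hσ.exists_improves_of_crit ha (Or.inr ⟨ha, hxa⟩) hrot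
      (fun h => hrotσ a h (σ.crit_subset_sel ha)) hown

theorem Balanced.exists_isFVS (hσ : σ.Balanced) (hG : G.edgeSet.Finite) :
    ∃ τ : Config G, τ.Balanced ∧ σ.sel ⊆ τ.sel ∧ IsFVS G τ.sel := by
  have hF : IsFVS G (edgeVerts hG.toFinset) := by
    simpa using isFVS_edgeVerts (E := hG.toFinset)
  induction hn : #hG.toFinset + 5 * #(edgeVerts hG.toFinset) - (#σ.edges + #σ.sel)
    using Nat.strong_induction_on generalizing σ with | _ n ih =>
  by_cases hsel : IsFVS G σ.sel
  · exact ⟨σ, hσ, subset_rfl, hsel⟩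
  obtain ⟨τ, hτ⟩ := hσ.exists_improves hsel
  have hedges : #τ.edges ≤ #hG.toFinset :=
    card_le_card fun e he => hG.mem_toFinset.2 (τ.edges_subset he)
  have hcard := hτ.balanced.card_sel_le hF
  have hlt := hτ.lt
  obtain ⟨ρ, hρ, hτρ, hFVS⟩ := ih _ (by omega) hτ.balanced rfl
  exact ⟨ρ, hρ, hτ.sel_subset.trans hτρ, hFVS⟩

end Augmentation

end Config

section Rules

/-- A rule that keeps, for every graph revealed so far, a feedback vertex set of it; the sets grow
with the graph and exceed the optimum at most by the factor `c`. -/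
structure IsFVSRule (c : ℕ) (P : (i : ℕ) → SimpleGraph (Fin i) → Finset (Fin i)) : Prop where
  map_subset : ∀ {i j : ℕ} (hij : i ≤ j) (G : SimpleGraph (Fin j)),
    (P i (revealed G i hij)).map (Fin.castLEEmb hij) ⊆ P j G
  isFVS : ∀ {i : ℕ} (G : SimpleGraph (Fin i)), IsFVS G (P i G)
  card_le : ∀ {i : ℕ} (G : SimpleGraph (Fin i)), #(P i G) ≤ c * opt G

variable {P : (i : ℕ) → SimpleGraph (Fin i) → Finset (Fin i)} {c n : ℕ}

theorem IsFVSRule.mono (hP : IsFVSRule c P) (G : SimpleGraph (Fin n)) {i j : ℕ} (hij : i ≤ j)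
    (hj : j ≤ n) : (P i (revealed G i (hij.trans hj))).map (Fin.castLEEmb (hij.trans hj)) ⊆
      (P j (revealed G j hj)).map (Fin.castLEEmb hj) := by
  have h := map_subset_map (f := Fin.castLEEmb hj).2 (hP.map_subset hij (revealed G j hj))
  rwa [Finset.map_map] at h

theorem IsFVS.isAcyclic_induce_of_revealed {G : SimpleGraph (Fin n)} {i : ℕ} {hi : i ≤ n}
    {S : Finset (Fin i)} (hS : IsFVS (revealed G i hi) S) {T : Set (Fin n)}
    (hT : ∀ v ∈ T, v.val < i ∧ v ∉ S.map (Fin.castLEEmb hi)) : (G.induce T).IsAcyclic := by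
  let f : G.induce T →g (revealed G i hi).induce (S : Set (Fin i))ᶜ :=
    { toFun := fun v => ⟨⟨v.1, (hT v v.2).1⟩, fun hv => (hT v v.2).2 (mem_map.2 ⟨_, hv, rfl⟩)⟩
      map_rel' := fun h => h }
  have hf : Function.Injective f := fun u v huv =>
    Subtype.ext (Fin.ext (congrArg (fun w => w.1.val) huv))
  exact IsAcyclic.comap f hf hS

/-- The strategy that selects the vertices prescribed by `P`, and reserves none. -/
def selectAll (P : (i : ℕ) → SimpleGraph (Fin i) → Finset (Fin i)) : OnlineStrategy where
  select := P
  reserve _ _ := ∅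

/-- The strategy that reserves the vertices prescribed by `P`, and selects none. -/
def reserveAll (P : (i : ℕ) → SimpleGraph (Fin i) → Finset (Fin i)) : OnlineStrategy where
  select _ _ := ∅
  reserve := P

theorem IsFVSRule.isAlgorithm_selectAll (hP : IsFVSRule c P) : (selectAll P).IsAlgorithm where
  selected_mono _ G _ _ := hP.mono G
  reserved_mono _ _ _ _ _ _ := subset_rfl
  valid _ G i hi := (hP.isFVS (revealed G i hi)).isAcyclic_induce_of_revealed
    fun _ hv => ⟨hv.1, hv.2.1⟩

theorem IsFVSRule.isAlgorithm_reserveAll (hP : IsFVSRule c P) : (reserveAll P).IsAlgorithm where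
  selected_mono _ _ _ _ _ _ := subset_rfl
  reserved_mono _ G _ _ := hP.mono G
  valid _ G i hi := (hP.isFVS (revealed G i hi)).isAcyclic_induce_of_revealed
    fun _ hv => ⟨hv.1, hv.2.2⟩

theorem completionSize_eq_zero {G : SimpleGraph (Fin n)} {S : Finset (Fin n)} (hS : IsFVS G S) :
    completionSize G S = 0 :=
  Nat.le_zero.1 (Nat.sInf_le ⟨∅, by simpa using hS, rfl⟩)

theorem completionSize_empty (G : SimpleGraph (Fin n)) : completionSize G ∅ = opt G := by
  simp [completionSize, opt]

theorem map_castLEEmb_le_rfl (S : Finset (Fin n)) : S.map (Fin.castLEEmb le_rfl) = S := by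
  simp [Finset.ext_iff]

theorem selected_length (A : OnlineStrategy) (G : SimpleGraph (Fin n)) :
    A.selected G n le_rfl = A.select n G :=
  map_castLEEmb_le_rfl _

theorem reserved_length (A : OnlineStrategy) (G : SimpleGraph (Fin n)) :
    A.reserved G n le_rfl = A.reserve n G :=
  map_castLEEmb_le_rfl _

theorem IsFVSRule.isCompetitive_selectAll (hP : IsFVSRule c P) (α : ℝ) :
    (selectAll P).IsCompetitive α c := by
  intro n G
  rw [OnlineStrategy.cost, selected_length, reserved_length]
  simpa [selectAll, completionSize_eq_zero (hP.isFVS G)] using mod_cast hP.card_le G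

theorem IsFVSRule.isCompetitive_reserveAll (hP : IsFVSRule c P) {α : ℝ} (hα : 0 ≤ α) :
    (reserveAll P).IsCompetitive α (1 + c * α) := by
  intro n G
  rw [OnlineStrategy.cost, selected_length, reserved_length]
  have hcard : (#(P n G) : ℝ) ≤ c * opt G := mod_cast hP.card_le G
  calc (#(∅ : Finset (Fin n)) : ℝ) + completionSize G ∅ + α * #(P n G)
      = opt G + α * #(P n G) := by simp [completionSize_empty]
    _ ≤ opt G + α * (c * opt G) := by gcongr
    _ = (1 + c * α) * opt G := by ring

end Rules

section Saturation

/-- The revealed graph as a graph on the natural numbers, so that the configurations at different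
stages live on the same vertices. -/
def natGraph {n : ℕ} (G : SimpleGraph (Fin n)) : SimpleGraph ℕ := G.map Fin.valEmbedding

variable {n : ℕ}

theorem natGraph_revealed_le {i : ℕ} (G : SimpleGraph (Fin n)) (hi : i ≤ n) :
    natGraph (revealed G i hi) ≤ natGraph G := by
  intro x y hxy
  obtain ⟨u, v, huv, rfl, rfl⟩ := (map_adj _ _ _ _).1 hxy
  exact (map_adj _ _ _ _).2 ⟨Fin.castLE hi u, Fin.castLE hi v, huv, rfl, rfl⟩

theorem finite_edgeSet_natGraph (G : SimpleGraph (Fin n)) : (natGraph G).edgeSet.Finite := by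
  rw [natGraph, edgeSet_map]
  exact (Set.toFinite _).image _

/-- The balanced configurations of a graph. -/
abbrev BalancedConfig {V : Type*} [DecidableEq V] (G : SimpleGraph V) :=
  {σ : Config G // σ.Balanced}

/-- Some balanced configuration that selects a feedback vertex set and extends the given one. -/
noncomputable def saturate {G : SimpleGraph (Fin n)} (σ : BalancedConfig (natGraph G)) :
    BalancedConfig (natGraph G) :=
  have h := σ.2.exists_isFVS (finite_edgeSet_natGraph G)
  ⟨h.choose, h.choose_spec.1⟩

theorem sel_subset_sel_saturate {G : SimpleGraph (Fin n)} (σ : BalancedConfig (natGraph G)) :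
    σ.1.sel ⊆ (saturate σ).1.sel :=
  (σ.2.exists_isFVS (finite_edgeSet_natGraph G)).choose_spec.2.1

theorem isFVS_sel_saturate {G : SimpleGraph (Fin n)} (σ : BalancedConfig (natGraph G)) :
    IsFVS (natGraph G) (saturate σ).1.sel :=
  (σ.2.exists_isFVS (finite_edgeSet_natGraph G)).choose_spec.2.2

/-- The configuration kept by the online algorithm after each vertex of `G` has been presented. -/
noncomputable def stage : (i : ℕ) → (G : SimpleGraph (Fin i)) → BalancedConfig (natGraph G)
  | 0, _ => saturate ⟨Config.empty _, Config.balanced_empty _⟩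
  | i + 1, G =>
    let σ := stage i (revealed G i i.le_succ)
    saturate ⟨σ.1.mono (natGraph_revealed_le G i.le_succ), σ.2.mono _⟩

theorem isFVS_sel_stage (G : SimpleGraph (Fin n)) : IsFVS (natGraph G) (stage n G).1.sel := by
  cases n <;> exact isFVS_sel_saturate _

theorem sel_stage_revealed_subset_succ (G : SimpleGraph (Fin (n + 1))) :
    (stage n (revealed G n n.le_succ)).1.sel ⊆ (stage (n + 1) G).1.sel :=
  let σ := stage n (revealed G n n.le_succ)
  sel_subset_sel_saturate ⟨σ.1.mono (natGraph_revealed_le G n.le_succ), σ.2.mono _⟩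

theorem sel_stage_revealed_subset {i : ℕ} (hi : i ≤ n) (G : SimpleGraph (Fin n)) :
    (stage i (revealed G i hi)).1.sel ⊆ (stage n G).1.sel := by
  induction n, hi using Nat.le_induction with
  | base => exact subset_rfl
  | succ j hj ih => exact (ih (revealed G j j.le_succ)).trans (sel_stage_revealed_subset_succ G)

/-- The vertices of `G` selected by the configuration at its last stage. -/
noncomputable def stageSel (i : ℕ) (G : SimpleGraph (Fin i)) : Finset (Fin i) :=
  {v | v.val ∈ (stage i G).1.sel}

theorem isFVSRule_stageSel : IsFVSRule 5 stageSel where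
  map_subset hij G v hv := by
    obtain ⟨u, hu, rfl⟩ := mem_map.1 hv
    simp only [stageSel, mem_filter_univ] at hu ⊢
    exact sel_stage_revealed_subset hij G hu
  isFVS G := by
    rw [stageSel, coe_filter_univ]
    exact (isFVS_sel_stage G).comap (Embedding.map Fin.valEmbedding G).toHom Fin.val_injective
  card_le {i} G := by
    obtain ⟨F, hF, hcard⟩ := opt_spec G
    have hF' : IsFVS (natGraph G) (F.map Fin.valEmbedding) := by
      rw [coe_map]
      exact hF.map Fin.valEmbedding
    calc #(stageSel i G) ≤ #(stage i G).1.sel :=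
          card_le_card_of_injOn Fin.val (fun v hv => by simpa [stageSel] using hv)
            Fin.val_injective.injOn
      _ ≤ 5 * #(F.map Fin.valEmbedding) := (stage i G).2.card_sel_le hF'
      _ = 5 * opt G := by rw [card_map, hcard]

end Saturation

end DelayedFVS

theorem mainTheorem7 (α : ℝ) (hα : 0 ≤ α) :
    ∃ A : DelayedFVS.OnlineStrategy,
      A.IsAlgorithm ∧ A.IsCompetitive α (min 5 (1 + 5 * α)) := by
  have hrule := DelayedFVS.isFVSRule_stageSel
  rcases le_total 5 (1 + 5 * α) with h | h
  · rw [min_eq_left h]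
    exact ⟨_, hrule.isAlgorithm_selectAll, mod_cast hrule.isCompetitive_selectAll α⟩
  · rw [min_eq_right h]
    exact ⟨_, hrule.isAlgorithm_reserveAll, mod_cast hrule.isCompetitive_reserveAll hα⟩
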